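/- Let $X$ be a proper $\mathrm{CAT}(0)$ space (a proper geodesic metric space whose geodesic triangles are not fatter than their Euclidean comparison triangles), with boundary at infinity $\partial X$ (asymptote classes of geodesic rays; two rays are asymptotic if they stay at bounded distance from one another). Let $R:\mathbf R\to X$ be a geodesic line with positive endpoint $R(+\infty)\in\partial X$, let $y\in\partial X$ and $d>0$. Let $(R_k)_{k\in\mathbf N}$ be a sequence of geodesic lines $R_k:\mathbf R\to X$ whose images lie at Hausdorff distance at most $d$ from the image of $R$, and let $(t_k)_{k\in\mathbf N}$ be a sequence of reals such that $R_k(t_k)$ converges to $R(+\infty)$ in the cone topology on $X\cup\partial X$. Then $$\lim_{k\to\infty}\angle_{R_k(t_k)}\bigl(R(+\infty),y\bigr)=\angle\bigl(R(+\infty),y\bigr).$$ Here $\angle_p(\xi,\eta)$ is the Alexandrov angle at $p\in X$ between the rays issuing from $p$ in the classes $\xi,\eta\in\partial X$, and $\angle(\xi,\eta)=\lim_{t\to\infty}2\arcsin\bigl(d_X(\varphi(t),\psi(t))/(2t)\bigr)$ is the Tits angle, where $d_X$ is the metric of $X$ and $\varphi,\psi$ are rays with a common origin in the classes $\xi,\eta$.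 -/

import Mathlib

open Filter Topology
open scoped NNReal

namespace CatZero

/-- `γ` restricted to `[0, dist x y]` is a geodesic segment from `x` to `y`. -/
structure IsGeodesicSegment {X : Type*} [MetricSpace X] (γ : ℝ → X) (x y : X) : Prop where
  source : γ 0 = x
  target : γ (dist x y) = y
  dist_eq : ∀ s ∈ Set.Icc 0 (dist x y), ∀ t ∈ Set.Icc 0 (dist x y), dist (γ s) (γ t) = |s - t|

/-- `X` is a CAT(0) space: it is a geodesic space, and geodesic triangles are not fatter than
their Euclidean comparison triangles. Any two sides of a triangle share a vertex, here called `p`,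
the sides being `σ` (from `p` to `q`) and `τ` (from `p` to `r`); `p' q' r'` is a comparison
triangle in the Euclidean plane, and `x'`, `y'` are the comparison points of `σ s`, `τ t`. -/
structure IsCATZero (X : Type*) [MetricSpace X] : Prop where
  exists_geodesic : ∀ x y : X, ∃ γ : ℝ → X, IsGeodesicSegment γ x y
  comparison : ∀ (p q r : X) (σ τ : ℝ → X), IsGeodesicSegment σ p q → IsGeodesicSegment τ p r →
    ∀ p' q' r' : EuclideanSpace ℝ (Fin 2),
      dist p' q' = dist p q → dist p' r' = dist p r → dist q' r' = dist q r →
    ∀ s ∈ Set.Icc 0 (dist p q), ∀ t ∈ Set.Icc 0 (dist p r),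
    ∀ x' ∈ segment ℝ p' q', ∀ y' ∈ segment ℝ p' r', dist p' x' = s → dist p' y' = t →
      dist (σ s) (τ t) ≤ dist x' y'

/-- A geodesic ray: an isometric embedding of `[0, ∞)`. -/
structure GeodesicRay (X : Type*) [MetricSpace X] where
  toFun : ℝ≥0 → X
  isometry : Isometry toFun

instance {X : Type*} [MetricSpace X] : CoeFun (GeodesicRay X) (fun _ => ℝ≥0 → X) :=
  ⟨GeodesicRay.toFun⟩

/-- A (parametrized) geodesic line: an isometric embedding of `ℝ`. -/
structure GeodesicLine (X : Type*) [MetricSpace X] where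
  toFun : ℝ → X
  isometry : Isometry toFun

instance {X : Type*} [MetricSpace X] : CoeFun (GeodesicLine X) (fun _ => ℝ → X) :=
  ⟨GeodesicLine.toFun⟩

/-- Two rays are asymptotic if they stay at uniformly bounded distance. -/
def Asymptotic {X : Type*} [MetricSpace X] (c c' : GeodesicRay X) : Prop :=
  ∃ K : ℝ, ∀ t : ℝ≥0, dist (c t) (c' t) ≤ K

instance asymptoticSetoid (X : Type*) [MetricSpace X] : Setoid (GeodesicRay X) where
  r := Asymptotic
  iseqv :=
    { refl := fun c => ⟨0, fun t => (dist_self (c t)).le⟩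
      symm := fun ⟨K, h⟩ => ⟨K, fun t => by rw [dist_comm]; exact h t⟩
      trans := fun ⟨K, h⟩ ⟨L, h'⟩ =>
        ⟨K + L, fun t => (dist_triangle _ _ _).trans (add_le_add (h t) (h' t))⟩ }

/-- The boundary at infinity: asymptote classes of geodesic rays. -/
def Boundary (X : Type*) [MetricSpace X] : Type _ := Quotient (asymptoticSetoid X)

/-- The endpoint `c(∞)` of a ray. -/
def GeodesicRay.endpoint {X : Type*} [MetricSpace X] (c : GeodesicRay X) : Boundary X :=
  Quotient.mk (asymptoticSetoid X) c

/-- The positive half of a line. -/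
def GeodesicLine.posRay {X : Type*} [MetricSpace X] (R : GeodesicLine X) : GeodesicRay X where
  toFun t := R (t : ℝ)
  isometry := R.isometry.comp isometry_subtype_coe

/-- The endpoint `R(+∞)` of a line. -/
def GeodesicLine.posEnd {X : Type*} [MetricSpace X] (R : GeodesicLine X) : Boundary X :=
  R.posRay.endpoint

theorem GeodesicRay.exists_endpoint_eq {X : Type*} [MetricSpace X] (ξ : Boundary X) :
    ∃ c : GeodesicRay X, c.endpoint = ξ :=
  Quotient.exists_rep ξ

/-- The ray issuing from `p` in the class `ξ`. (In a complete CAT(0) space there is exactly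
one.) -/
noncomputable def rayFrom {X : Type*} [MetricSpace X] (p : X) (ξ : Boundary X) : GeodesicRay X :=
  @Classical.epsilon (GeodesicRay X) ⟨(GeodesicRay.exists_endpoint_eq ξ).choose⟩
    (fun c => c 0 = p ∧ c.endpoint = ξ)

/-- The angle opposite to the side `c` in a Euclidean triangle with side lengths `a, b, c`. -/
noncomputable def comparisonAngle (a b c : ℝ) : ℝ :=
  Real.arccos ((a ^ 2 + b ^ 2 - c ^ 2) / (2 * a * b))

/-- The Alexandrov angle between two rays (used for rays with the same origin): the upper limit,
as `s, t → 0+`, of the comparison angles at the origin of the triangle with vertices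
the origin, `c s` and `c' t`. -/
noncomputable def alexandrovAngle {X : Type*} [MetricSpace X] (c c' : GeodesicRay X) : ℝ :=
  limsup (fun q : ℝ≥0 × ℝ≥0 =>
      comparisonAngle (dist (c 0) (c q.1)) (dist (c 0) (c' q.2)) (dist (c q.1) (c' q.2)))
    (𝓝[>] 0 ×ˢ 𝓝[>] 0)

/-- The angle `∠_p(ξ, η)` at a point `p` between two boundary points. -/
noncomputable def angleAt {X : Type*} [MetricSpace X] (p : X) (ξ η : Boundary X) : ℝ :=
  alexandrovAngle (rayFrom p ξ) (rayFrom p η)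

/-- `lim_{t → ∞} 2 arcsin (d(c(t), c'(t)) / 2t)`. -/
noncomputable def titsAngleRays {X : Type*} [MetricSpace X] (c c' : GeodesicRay X) : ℝ :=
  limUnder atTop (fun t : ℝ≥0 => 2 * Real.arcsin (dist (c t) (c' t) / (2 * (t : ℝ))))

theorem tendsto_arcsin_sub {u v : ℝ≥0 → ℝ} (h : Tendsto (fun t => u t - v t) atTop (𝓝 0)) :
    Tendsto (fun t => 2 * Real.arcsin (u t) - 2 * Real.arcsin (v t)) atTop (𝓝 0) := by
  have huc : UniformContinuous Real.arcsin := by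
    have h1 : UniformContinuous
        (fun x : Set.Icc (-1 : ℝ) 1 => Real.arcsin x) :=
      CompactSpace.uniformContinuous_of_continuous
        (Real.continuous_arcsin.comp continuous_subtype_val)
    have h2 : UniformContinuous (Set.projIcc (-1 : ℝ) 1 (by norm_num)) :=
      (LipschitzWith.projIcc (by norm_num)).uniformContinuous
    have h3 : Real.arcsin = (fun x : Set.Icc (-1 : ℝ) 1 => Real.arcsin x) ∘
        Set.projIcc (-1 : ℝ) 1 (by norm_num) := by
      funext x
      simp [Real.arcsin_projIcc]
    rw [h3]
    exact h1.comp h2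
  have h4 : Tendsto (fun t => Real.arcsin (u t) - Real.arcsin (v t)) atTop (𝓝 0) := by
    rw [Metric.tendsto_atTop] at h ⊢
    intro ε hε
    obtain ⟨δ, hδ, H⟩ := Metric.uniformContinuous_iff.1 huc ε hε
    obtain ⟨N, hN⟩ := h δ hδ
    refine ⟨N, fun n hn => ?_⟩
    have h5 := hN n hn
    rw [Real.dist_eq, sub_zero, ← Real.dist_eq] at h5 ⊢
    exact H h5
  simpa [mul_sub] using h4.const_mul 2

/-- The limit above depends only on the asymptote classes. -/
theorem titsAngleRays_congr {X : Type*} [MetricSpace X] (a b a' b' : GeodesicRay X)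
    (ha : Asymptotic a a') (hb : Asymptotic b b') : titsAngleRays a b = titsAngleRays a' b' := by
  obtain ⟨K, hK⟩ := ha
  obtain ⟨L, hL⟩ := hb
  have hlim : Tendsto (fun t : ℝ≥0 => dist (a t) (b t) / (2 * (t : ℝ)) -
      dist (a' t) (b' t) / (2 * (t : ℝ))) atTop (𝓝 0) := by
    have h0 : Tendsto (fun t : ℝ≥0 => (K + L) / (2 * (t : ℝ))) atTop (𝓝 0) :=
      tendsto_const_nhds.div_atTop
        ((NNReal.tendsto_coe_atTop.2 tendsto_id).const_mul_atTop two_pos)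
    refine squeeze_zero_norm (fun t => ?_) h0
    rw [← sub_div, Real.norm_eq_abs, abs_div, abs_of_nonneg (by positivity : (0 : ℝ) ≤ 2 * t)]
    refine div_le_div_of_nonneg_right ?_ (by positivity)
    have h1 := dist_dist_dist_le (a t) (b t) (a' t) (b' t)
    rw [Real.dist_eq] at h1
    exact h1.trans (add_le_add (hK t) (hL t))
  have hd := tendsto_arcsin_sub hlim
  unfold titsAngleRays limUnder lim
  congr 1
  funext x
  apply propext
  constructor
  · intro hx
    have h2 := Tendsto.sub (show Tendsto _ _ _ from hx) hd
    show Tendsto _ _ _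
    simpa using h2
  · intro hx
    have h2 := Tendsto.add (show Tendsto _ _ _ from hx) hd
    show Tendsto _ _ _
    simpa using h2

/-- The Tits angle `∠(ξ, η)`: the limit of `2 arcsin (d(φ(t), ψ(t)) / 2t)` for any rays `φ, ψ` in
the classes `ξ, η`, in particular for two such rays with a common origin. -/
noncomputable def titsAngle {X : Type*} [MetricSpace X] (ξ η : Boundary X) : ℝ :=
  Quotient.lift₂ titsAngleRays titsAngleRays_congr ξ η

/-- The trace on `X` of the neighbourhood filter of the boundary point `ξ` in the cone topology on
`X ∪ ∂X`. It is generated by the sets `U(c, r, ε)`, where `c` is a ray in the class `ξ` and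
`r ≥ 0`, `ε > 0`; a point `x` of `X` belongs to `U(c, r, ε)` when `d(c(0), x) > r` and the point
at distance `r` from `c(0)` on the geodesic from `c(0)` to `x` is at distance less than `ε`
from `c(r)`. -/
def coneNhds {X : Type*} [MetricSpace X] (ξ : Boundary X) : Filter X :=
  ⨅ (c : GeodesicRay X) (_ : c.endpoint = ξ) (r : ℝ≥0) (ε : ℝ) (_ : 0 < ε),
    𝓟 {x : X | (r : ℝ) < dist (c 0) x ∧
      ∀ γ : ℝ → X, IsGeodesicSegment γ (c 0) x → dist (γ r) (c r) < ε}

end CatZero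

/-!
Write `ξ` for the positive endpoint of `R` and `p k` for the point `Rk k (t k)`.

The angle at any point is at most the Tits angle: comparison angles increase along two rays with a
common origin, the Tits angle is their supremum (`IsCATZero.titsAngle_eq_iSup`), and the Alexandrov
angle is an upper limit of comparison angles (`IsCATZero.alexandrovAngle_le_titsAngle`).

For the converse, the part of the line `Rk k` behind `p k` is used. Up to a translation and a change
of direction, `Rk k` follows `R` within a constant distance `D`
(`GeodesicLine.exists_fellow_travel`); let `M k` be this reparametrization, with `M k 0 = p k` at
distance at most `D` from `R (a k)`. Convergence to `ξ` in the cone topology means that `a k` tends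
to `+∞` (`IsCATZero.tendsto_param_atTop`). Let `b` be the Busemann function of the ray from `R 0` to
`y`, and consider the triangle with vertices `p k`, `q k = M k (-a k)` and `y`. By comparison, the
cosine of the angle at `p k` between the backward half of `M k` and `y` is at least
`(b (p k) - b (q k)) / a k` (`IsCATZero.busemann_sub_div_le`). By the midpoint inequality at `p k`,
the cosine of the angle with the forward half, which is the ray to `ξ`, is at most the negative of
this number (`IsCATZero.arccos_le_alexandrovAngle`). As `p k` is close to `R (a k)` and `q k` is
close to `R 0`, the difference `b (p k) - b (q k)` is `b (R (a k)) - b (R 0)` up to `2 * D`, which is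
negligible against `a k`. Finally `b (R s) ≥ -s * (cos ∠(ξ, y) + ε)` for all large `s`
(`IsCATZero.neg_mul_le_busemann`), whence the lower bound for the angle at `p k`.
-/

namespace CatZero

variable {X : Type*} [MetricSpace X]

/-! ### The law of cosines inequality -/

/-- A comparison triangle, placed with one vertex at the origin. -/
theorem exists_comparison_triangle {a b c : ℝ} (ha : 0 < a) (hb : 0 < b) (hc : 0 ≤ c)
    (h₁ : c ≤ a + b) (h₂ : a ≤ b + c) (h₃ : b ≤ a + c) :
    ∃ q r : EuclideanSpace ℝ (Fin 2), ‖q‖ = a ∧ ‖r‖ = b ∧ dist q r = c := by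
  set k := (a ^ 2 + b ^ 2 - c ^ 2) / (2 * a * b) with hk
  have hkm : 2 * a * b * k = a ^ 2 + b ^ 2 - c ^ 2 := by
    rw [hk]; field_simp
  have hk1 : k ^ 2 ≤ 1 := by
    rw [sq_le_one_iff_abs_le_one, abs_le]
    constructor
    · rw [hk, le_div_iff₀ (by positivity)]; nlinarith
    · rw [hk, div_le_one (by positivity)]; nlinarith
  have hs := Real.sq_sqrt (sub_nonneg.2 hk1)
  refine ⟨!₂[a, 0], !₂[b * k, b * √(1 - k ^ 2)], ?_, ?_, ?_⟩
  · rw [EuclideanSpace.norm_eq]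
    simp [Real.sqrt_sq_eq_abs, abs_of_pos ha]
  · rw [EuclideanSpace.norm_eq, Real.sqrt_eq_iff_mul_self_eq (by positivity) hb.le]
    simp [Fin.sum_univ_two]
    nlinarith
  · rw [EuclideanSpace.dist_eq, Real.sqrt_eq_iff_mul_self_eq (by positivity) hc]
    simp [Fin.sum_univ_two, Real.dist_eq]
    nlinarith

/-- The comparison inequality for points on two sides of a triangle, the comparison distance being
given by the law of cosines. Denominators are cleared, so that no side need be nondegenerate. -/
theorem IsCATZero.mul_sq_dist_le (hX : IsCATZero X) {p q r : X} {σ τ : ℝ → X}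
    (hσ : IsGeodesicSegment σ p q) (hτ : IsGeodesicSegment τ p r) {s t : ℝ}
    (hs : s ∈ Set.Icc 0 (dist p q)) (ht : t ∈ Set.Icc 0 (dist p r)) :
    dist p q * dist p r * dist (σ s) (τ t) ^ 2 ≤
      dist p q * dist p r * (s ^ 2 + t ^ 2) -
        s * t * (dist p q ^ 2 + dist p r ^ 2 - dist q r ^ 2) := by
  rcases (dist_nonneg (x := p) (y := q)).eq_or_lt with ha | ha
  · have : s = 0 := le_antisymm (ha ▸ hs.2) hs.1
    simp [← ha, this]
  rcases (dist_nonneg (x := p) (y := r)).eq_or_lt with hb | hb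
  · have : t = 0 := le_antisymm (hb ▸ ht.2) ht.1
    simp [← hb, this]
  obtain ⟨q', r', hq, hr, hqr⟩ := exists_comparison_triangle ha hb (dist_nonneg (x := q) (y := r))
    (by rw [dist_comm p q]; exact dist_triangle q p r)
    (by rw [dist_comm q r]; exact dist_triangle p r q) (dist_triangle p q r)
  have hs' : s / dist p q ∈ Set.Icc (0 : ℝ) 1 :=
    ⟨div_nonneg hs.1 ha.le, (div_le_one ha).2 hs.2⟩
  have ht' : t / dist p r ∈ Set.Icc (0 : ℝ) 1 :=
    ⟨div_nonneg ht.1 hb.le, (div_le_one hb).2 ht.2⟩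
  have key := hX.comparison p q r σ τ hσ hτ 0 q' r' (by simpa using hq) (by simpa using hr) hqr
    s hs t ht ((s / dist p q) • q') (by
      rw [segment_eq_image]; exact ⟨_, hs', by simp⟩) ((t / dist p r) • r') (by
      rw [segment_eq_image]; exact ⟨_, ht', by simp⟩)
    (by rw [dist_zero_left, norm_smul, Real.norm_of_nonneg hs'.1, hq, div_mul_cancel₀ _ ha.ne'])
    (by rw [dist_zero_left, norm_smul, Real.norm_of_nonneg ht'.1, hr, div_mul_cancel₀ _ hb.ne'])
  have e1 : dist q r ^ 2 = dist p q ^ 2 - 2 * inner ℝ q' r' + dist p r ^ 2 := by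
    rw [← hqr, dist_eq_norm, norm_sub_sq_real, hq, hr]
  have e2 : dist ((s / dist p q) • q') ((t / dist p r) • r') ^ 2 =
      s ^ 2 - 2 * (s / dist p q * (t / dist p r) * inner ℝ q' r') + t ^ 2 := by
    rw [dist_eq_norm, norm_sub_sq_real, norm_smul, norm_smul, hq, hr,
      Real.norm_of_nonneg hs'.1, Real.norm_of_nonneg ht'.1, div_mul_cancel₀ _ ha.ne',
      div_mul_cancel₀ _ hb.ne', inner_smul_left, inner_smul_right]
    simp; ring
  calc _ ≤ dist p q * dist p r * dist ((s / dist p q) • q') ((t / dist p r) • r') ^ 2 := by gcongr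
    _ = _ := by rw [e1, e2]; field_simp; ring

/-- Comparison angles at a vertex decrease when the sides issuing from it are shortened. -/
theorem IsCATZero.cos_comparison_le (hX : IsCATZero X) {p q r : X} {σ τ : ℝ → X}
    (hσ : IsGeodesicSegment σ p q) (hτ : IsGeodesicSegment τ p r) {s t : ℝ}
    (hs : s ∈ Set.Ioc 0 (dist p q)) (ht : t ∈ Set.Ioc 0 (dist p r)) :
    (dist p q ^ 2 + dist p r ^ 2 - dist q r ^ 2) / (2 * dist p q * dist p r) ≤
      (s ^ 2 + t ^ 2 - dist (σ s) (τ t) ^ 2) / (2 * s * t) := by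
  have h := hX.mul_sq_dist_le hσ hτ (Set.Ioc_subset_Icc_self hs) (Set.Ioc_subset_Icc_self ht)
  have ha := hs.1.trans_le hs.2
  have hb := ht.1.trans_le ht.2
  have h1 := hs.1
  have h2 := ht.1
  rw [div_le_div_iff₀ (by positivity) (by positivity)]
  linarith

/-! ### Segments, rays and lines -/

theorem IsGeodesicSegment.reverse {γ : ℝ → X} {x y : X} (h : IsGeodesicSegment γ x y) :
    IsGeodesicSegment (fun s => γ (dist x y - s)) y x where
  source := by simpa using h.target
  target := by simpa [dist_comm y x] using h.source
  dist_eq s hs t ht := by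
    rw [dist_comm y x] at hs ht
    rw [h.dist_eq _ ⟨by linarith [hs.2], by linarith [hs.1]⟩ _
      ⟨by linarith [ht.2], by linarith [ht.1]⟩, abs_sub_comm]
    congr 1; ring

theorem GeodesicRay.dist_eq (c : GeodesicRay X) (s t : ℝ≥0) : dist (c s) (c t) = |(s : ℝ) - t| := by
  rw [c.isometry.dist_eq, NNReal.dist_eq]

theorem GeodesicRay.dist_zero (c : GeodesicRay X) (t : ℝ≥0) : dist (c 0) (c t) = t := by
  simp [c.dist_eq]

theorem GeodesicLine.dist_eq (L : GeodesicLine X) (s t : ℝ) : dist (L s) (L t) = |s - t| := by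
  rw [L.isometry.dist_eq, Real.dist_eq]

theorem GeodesicRay.isGeodesicSegment (c : GeodesicRay X) (T : ℝ≥0) :
    IsGeodesicSegment (fun s => c s.toNNReal) (c 0) (c T) where
  source := by simp
  target := by simp [c.dist_zero]
  dist_eq s hs t ht := by
    rw [c.dist_eq, Real.coe_toNNReal _ hs.1, Real.coe_toNNReal _ ht.1]

/-- The line `τ ↦ L (t + τ)`. -/
def GeodesicLine.shift (L : GeodesicLine X) (t : ℝ) : GeodesicLine X where
  toFun τ := L (t + τ)
  isometry := L.isometry.comp (isometry_add_left t)

/-- The line `L` run backwards. -/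
def GeodesicLine.reverse (L : GeodesicLine X) : GeodesicLine X where
  toFun τ := L (-τ)
  isometry := L.isometry.comp (IsometryEquiv.neg ℝ).isometry

theorem GeodesicLine.isGeodesicSegment (L : GeodesicLine X) {T : ℝ} (hT : 0 ≤ T) :
    IsGeodesicSegment L (L 0) (L T) where
  source := rfl
  target := by simp [L.dist_eq, abs_of_nonneg hT]
  dist_eq s _ t _ := L.dist_eq s t

/-- The comparison angles of two rays issuing from one point increase along the rays. -/
theorem IsCATZero.cos_comparison_ray_le (hX : IsCATZero X) {c c' : GeodesicRay X} (h0 : c 0 = c' 0)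
    {s t S T : ℝ≥0} (hs : 0 < s) (ht : 0 < t) (hsS : s ≤ S) (htT : t ≤ T) :
    ((S : ℝ) ^ 2 + T ^ 2 - dist (c S) (c' T) ^ 2) / (2 * S * T) ≤
      ((s : ℝ) ^ 2 + t ^ 2 - dist (c s) (c' t) ^ 2) / (2 * s * t) := by
  have h := hX.cos_comparison_le (s := s) (t := t) (c.isGeodesicSegment S)
    (h0 ▸ c'.isGeodesicSegment T) (by rw [c.dist_zero]; exact ⟨hs, hsS⟩)
    (by rw [h0, c'.dist_zero]; exact ⟨ht, htT⟩)
  simpa [c.dist_zero, show dist (c 0) (c' T) = T by rw [h0, c'.dist_zero]] using h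

/-- Asymptotic rays from one point agree: at time `t` they are at distance at most `t / T` times
their bounded distance at time `T`. -/
theorem IsCATZero.eq_of_asymptotic (hX : IsCATZero X) {c c' : GeodesicRay X} (h0 : c 0 = c' 0)
    (h : Asymptotic c c') : c = c' := by
  obtain ⟨K, hK⟩ := h
  have hfun : c.toFun = c'.toFun := by
    funext t
    by_contra hne
    have hd : 0 < dist (c t) (c' t) := dist_pos.2 hne
    have key : ∀ T : ℝ≥0, t ≤ T → (T : ℝ) * dist (c t) (c' t) ≤ t * K := by
      intro T hT
      have hT' : (t : ℝ) ≤ T := hT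
      have h := hX.mul_sq_dist_le (s := t) (t := t) (c.isGeodesicSegment T)
        (h0 ▸ c'.isGeodesicSegment T) (by rw [c.dist_zero]; exact ⟨t.2, hT⟩)
        (by rw [h0, c'.dist_zero]; exact ⟨t.2, hT⟩)
      simp only [c.dist_zero, show dist (c 0) (c' T) = T by rw [h0, c'.dist_zero],
        Real.toNNReal_coe] at h
      have hK0 : 0 ≤ K := dist_nonneg.trans (hK 0)
      refine le_of_sq_le_sq ?_ (by positivity)
      have h2 : dist (c T) (c' T) ^ 2 ≤ K ^ 2 := by gcongr; exact hK T
      nlinarith [mul_le_mul_of_nonneg_left h2 (sq_nonneg (t : ℝ))]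
    obtain ⟨N, hN⟩ := exists_nat_gt (t * K / dist (c t) (c' t))
    have h1 := key (max t N) (le_max_left _ _)
    rw [div_lt_iff₀ hd] at hN
    have h2 : (N : ℝ) ≤ (max t (N : ℝ≥0) : ℝ≥0) := by
      exact_mod_cast le_max_right t (N : ℝ≥0)
    nlinarith
  cases c; cases c'; congr

/-! ### Rays with prescribed origin and endpoint -/

/-- The ray from `p` asymptotic to `c` is a limit of the segments from `p` to `c n`. Bounded subsets
of `X` being relatively compact, an ultrafilter provides the limit without a Cauchy argument. -/
theorem IsCATZero.exists_asymptotic_ray [ProperSpace X] (hX : IsCATZero X) (c : GeodesicRay X)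
    (p : X) : ∃ (c' : GeodesicRay X) (σ : ℕ → ℝ → X), c' 0 = p ∧ Asymptotic c' c ∧
      (∀ n : ℕ, IsGeodesicSegment (σ n) p (c n)) ∧
      ∀ t : ℝ≥0, Tendsto (fun n => σ n t) (hyperfilter ℕ) (𝓝 (c' t)) := by
  choose σ hσ using fun n : ℕ => hX.exists_geodesic p (c n)
  have hfar : ∀ n : ℕ, (n : ℝ) - dist p (c 0) ≤ dist p (c n) := fun n => by
    have h1 := dist_triangle (c 0) p (c n)
    rw [c.dist_zero, dist_comm (c 0)] at h1
    push_cast at h1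
    linarith
  have hev : ∀ t : ℝ, ∀ᶠ n : ℕ in (hyperfilter ℕ : Filter ℕ), t ≤ dist p (c n) := fun t => by
    refine Nat.hyperfilter_le_atTop ?_
    filter_upwards [eventually_ge_atTop ⌈t + dist p (c 0)⌉₊] with n hn
    have := Nat.ceil_le.1 hn
    linarith [hfar n]
  have hlim : ∀ t : ℝ≥0, ∃ x, Tendsto (fun n => σ n t) (hyperfilter ℕ) (𝓝 x) := fun t => by
    obtain ⟨x, -, hx⟩ := (isCompact_closedBall p (t : ℝ)).ultrafilter_le_nhds
      ((hyperfilter ℕ).map fun n => σ n t) (by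
        rw [le_principal_iff, Ultrafilter.mem_coe, Ultrafilter.mem_map, ← Ultrafilter.mem_coe]
        filter_upwards [hev t] with n hn
        have h1 := (hσ n).dist_eq t ⟨t.2, hn⟩ 0 ⟨le_rfl, dist_nonneg⟩
        rw [(hσ n).source, sub_zero, NNReal.abs_eq] at h1
        exact Metric.mem_closedBall.2 h1.le)
    exact ⟨x, hx⟩
  choose f hf using hlim
  have hiso : Isometry f := Isometry.of_dist_eq fun s t => by
    refine tendsto_nhds_unique ((hf s).dist (hf t)) (tendsto_const_nhds.congr' ?_)
    filter_upwards [hev s, hev t] with n hs ht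
    rw [(hσ n).dist_eq s ⟨s.2, hs⟩ t ⟨t.2, ht⟩, NNReal.dist_eq]
  refine ⟨⟨f, hiso⟩, σ, ?_, ⟨2 * dist p (c 0), fun t => ?_⟩, hσ, hf⟩
  · exact tendsto_nhds_unique (hf 0) (tendsto_const_nhds.congr fun n => by simp [(hσ n).source])
  · refine le_of_tendsto ((hf t).dist tendsto_const_nhds) ?_
    filter_upwards [hev t, hev 1, Nat.hyperfilter_le_atTop
      (eventually_ge_atTop (⌈t⌉₊ + 1))] with n hn h1 hnt
    have hnt' : (t : ℝ) ≤ n ∧ (1 : ℝ) ≤ n :=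
      ⟨by exact_mod_cast (Nat.le_ceil t).trans (Nat.cast_le.2 ((Nat.le_succ _).trans hnt)),
        by exact_mod_cast (Nat.le_add_left 1 _).trans hnt⟩
    have hcn : dist (c n) (c 0) = n := by rw [dist_comm, c.dist_zero]; simp
    -- Both segments are run from `c n`, so that comparison of the triangle `c n`, `p`, `c 0` applies.
    have h := hX.mul_sq_dist_le (s := dist p (c n) - t) (t := n - t) (hσ n).reverse
      (c.isGeodesicSegment n).reverse
      ⟨by linarith, by rw [dist_comm]; linarith [t.2]⟩ ⟨by linarith, by rw [hcn]; linarith [t.2]⟩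
    rw [hcn, c.dist_zero, dist_comm (c n) p] at h
    simp only [sub_sub_cancel, NNReal.coe_natCast, Real.toNNReal_coe] at h
    have hup : dist p (c n) ≤ n + dist p (c 0) := by
      have := dist_triangle p (c 0) (c n)
      rw [c.dist_zero] at this
      push_cast at this
      linarith
    have hlow := hfar n
    generalize dist p (c n) = a at *
    generalize dist p (c 0) = K at *
    have hdiff : (a - n) ^ 2 ≤ K ^ 2 := sq_le_sq' (by linarith) (by linarith)
    have han : 0 < a * n := by nlinarith
    have hst : (a - t) * (n - t) ≤ a * n :=
      mul_le_mul (by linarith [t.2]) (by linarith [t.2]) (by linarith) (by linarith)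
    have hK : 0 ≤ K := by linarith
    refine le_of_sq_le_sq (le_of_mul_le_mul_left ?_ han) (by positivity)
    have h2 : 0 ≤ (a - t) * (n - t) := mul_nonneg (by linarith) (by linarith)
    nlinarith [mul_le_mul_of_nonneg_left hdiff han.le,
      mul_le_mul_of_nonneg_right hst (sq_nonneg K), mul_nonneg h2 (sq_nonneg (a - n)),
      mul_nonneg han.le (sq_nonneg K)]

theorem endpoint_eq_iff {c c' : GeodesicRay X} : c.endpoint = c'.endpoint ↔ Asymptotic c c' :=
  Quotient.eq (r := asymptoticSetoid X)

theorem IsCATZero.rayFrom_spec [ProperSpace X] (hX : IsCATZero X) (p : X) (ξ : Boundary X) :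
    (rayFrom p ξ) 0 = p ∧ (rayFrom p ξ).endpoint = ξ := by
  obtain ⟨c, rfl⟩ := GeodesicRay.exists_endpoint_eq ξ
  obtain ⟨c', -, h0, h, -⟩ := hX.exists_asymptotic_ray c p
  exact Classical.epsilon_spec (p := fun c' : GeodesicRay X => c' 0 = p ∧ c'.endpoint = c.endpoint)
    ⟨c', h0, endpoint_eq_iff.2 h⟩

theorem IsCATZero.rayFrom_eq [ProperSpace X] (hX : IsCATZero X) {p : X} {ξ : Boundary X}
    {c : GeodesicRay X} (h0 : c 0 = p) (h : c.endpoint = ξ) : rayFrom p ξ = c := by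
  obtain ⟨h0', h'⟩ := hX.rayFrom_spec p ξ
  exact hX.eq_of_asymptotic (h0'.trans h0.symm) (endpoint_eq_iff.1 (h'.trans h.symm))

/-! ### Busemann functions -/

/-- The Busemann function of the ray `c`, normalized to vanish at `c 0`. The distances
`dist x (c n) - n` decrease with `n`, so that their infimum is their limit. -/
noncomputable def busemann (c : GeodesicRay X) (x : X) : ℝ :=
  ⨅ n : ℕ, (dist x (c n) - n)

theorem tendsto_busemann (c : GeodesicRay X) (x : X) :
    Tendsto (fun n : ℕ => dist x (c n) - n) atTop (𝓝 (busemann c x)) := by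
  refine tendsto_atTop_ciInf (antitone_nat_of_succ_le fun n => ?_) ⟨-dist x (c 0), ?_⟩
  · have h := dist_triangle x (c n) (c (n + 1 : ℕ))
    rw [c.dist_eq] at h
    push_cast at h ⊢
    rw [sub_add_cancel_left, abs_neg, abs_one] at h
    linarith
  · rintro _ ⟨n, rfl⟩
    have h := dist_triangle (c 0) x (c n)
    rw [c.dist_zero, dist_comm (c 0)] at h
    push_cast at h
    simp only
    linarith

theorem busemann_self (c : GeodesicRay X) : busemann c (c 0) = 0 :=
  tendsto_nhds_unique (tendsto_busemann c (c 0))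
    (tendsto_const_nhds.congr fun n => by simp [c.dist_zero])

theorem busemann_sub_le (c : GeodesicRay X) (x y : X) :
    busemann c x - busemann c y ≤ dist x y :=
  le_of_tendsto ((tendsto_busemann c x).sub (tendsto_busemann c y))
    (.of_forall fun n => by linarith [dist_triangle x y (c n)])

theorem tendsto_dist_ray (c : GeodesicRay X) (x : X) :
    Tendsto (fun n : ℕ => dist x (c n)) atTop atTop :=
  ((tendsto_busemann c x).add_atTop tendsto_natCast_atTop_atTop).congr fun n => by ring

/-- As the vertex `c n` of a triangle `p q (c n)` recedes to infinity, the cosine of its comparison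
angle at `p` tends to a difference quotient of the Busemann function. -/
theorem tendsto_cos_comparison (c : GeodesicRay X) (p q : X) {T : ℝ} (hT : 0 < T) :
    Tendsto (fun n : ℕ =>
        (T ^ 2 + dist p (c n) ^ 2 - dist q (c n) ^ 2) / (2 * T * dist p (c n))) atTop
      (𝓝 ((busemann c p - busemann c q) / T)) := by
  have hx := (tendsto_busemann c p).sub (tendsto_busemann c q)
  have hD := tendsto_dist_ray c p
  have h1 := ((hx.pow 2).const_sub (T ^ 2)).div_atTop
    (hD.const_mul_atTop (by positivity : 0 < 2 * T))
  -- With `x = dist p (c n)` and `y = dist q (c n)`, the quotient is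
  -- `(T ^ 2 - (x - y) ^ 2) / (2 * T * x) + (x - y) / T`.
  have h2 := h1.add (hx.div_const T)
  rw [zero_add] at h2
  refine h2.congr' ?_
  filter_upwards [hD.eventually_gt_atTop 0] with n hn
  field_simp
  ring

/-- The comparison angle at the origin of `c'` between a point of the segment to `q` and a point
of `c'` is at most the ideal comparison angle of the triangle with vertices `c' 0`, `q` and the
endpoint of `c`. -/
theorem IsCATZero.busemann_sub_div_le [ProperSpace X] (hX : IsCATZero X) {c c' : GeodesicRay X}
    (h : Asymptotic c' c) {q : X} {τ : ℝ → X} (hτ : IsGeodesicSegment τ (c' 0) q) {u : ℝ} {v : ℝ≥0}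
    (hu : u ∈ Set.Ioc 0 (dist (c' 0) q)) (hv : 0 < v) :
    (busemann c (c' 0) - busemann c q) / dist (c' 0) q ≤
      (u ^ 2 + v ^ 2 - dist (τ u) (c' v) ^ 2) / (2 * u * v) := by
  obtain ⟨c'', σ, h0, h', hσ, hlim⟩ := hX.exists_asymptotic_ray c (c' 0)
  obtain rfl : c'' = c' := hX.eq_of_asymptotic h0
    (endpoint_eq_iff.1 ((endpoint_eq_iff.2 h').trans (endpoint_eq_iff.2 h).symm))
  refine le_of_tendsto_of_tendsto ((tendsto_cos_comparison c (c'' 0) q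
    (hu.1.trans_le hu.2)).mono_left Nat.hyperfilter_le_atTop)
    ((((tendsto_const_nhds.dist (hlim v)).pow 2).const_sub _).div_const _) ?_
  filter_upwards [Nat.hyperfilter_le_atTop
    ((tendsto_dist_ray c (c'' 0)).eventually_ge_atTop (v : ℝ))] with n hn
  exact hX.cos_comparison_le hτ (hσ n) hu ⟨hv, hn⟩

/-- If a comparison angle of two rays has cosine at most `κ`, then from there on the Busemann
function of one ray decreases at most at mean rate `κ` along the other one. -/
theorem IsCATZero.neg_mul_le_busemann (hX : IsCATZero X) {c c' : GeodesicRay X} (h0 : c 0 = c' 0)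
    {s t S : ℝ≥0} (hs : 0 < s) (ht : 0 < t) (hS : s ≤ S) {κ : ℝ}
    (hκ : ((s : ℝ) ^ 2 + t ^ 2 - dist (c s) (c' t) ^ 2) / (2 * s * t) ≤ κ) :
    -(S * κ) ≤ busemann c' (c S) := by
  have hS0 : (0 : ℝ) < S := hs.trans_le hS
  have h := tendsto_cos_comparison c' (c' 0) (c S) hS0
  rw [busemann_self, zero_sub] at h
  have hle : -busemann c' (c S) / S ≤ κ := by
    refine le_of_tendsto h ?_
    filter_upwards [eventually_ge_atTop ⌈t⌉₊] with n hn
    rw [c'.dist_zero]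
    exact (hX.cos_comparison_ray_le h0 hs ht hS (Nat.ceil_le.1 hn)).trans hκ
  rw [div_le_iff₀ hS0] at hle
  linarith

/-! ### Tits angles as suprema of comparison angles -/

theorem two_mul_arcsin_eq_comparisonAngle {t x : ℝ} (ht : 0 < t) (hx0 : 0 ≤ x) (hx : x ≤ 2 * t) :
    2 * Real.arcsin (x / (2 * t)) = comparisonAngle t t x := by
  have h0 : 0 ≤ x / (2 * t) := by positivity
  have h1 : x / (2 * t) ≤ 1 := (div_le_one (by positivity)).2 hx
  have h2 := Real.arcsin_nonneg.2 h0
  have h3 := Real.arcsin_le_pi_div_two (x / (2 * t))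
  rw [comparisonAngle, ← Real.arccos_cos (x := 2 * Real.arcsin (x / (2 * t))) (by linarith)
    (by linarith), Real.cos_two_mul', Real.cos_sq', Real.sin_arcsin (by linarith) h1]
  congr 1
  field_simp
  ring

theorem dist_ray_le {c c' : GeodesicRay X} (h0 : c 0 = c' 0) (t : ℝ≥0) :
    dist (c t) (c' t) ≤ 2 * t := by
  have h := dist_triangle_left (c t) (c' t) (c 0)
  rw [c.dist_zero, h0, c'.dist_zero] at h
  linarith

/-- The angles whose limit defines the Tits angle increase; at `t = 0` the quotient `0 / 0 = 0`
keeps the function monotone. -/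
theorem IsCATZero.monotone_arcsin (hX : IsCATZero X) {c c' : GeodesicRay X} (h0 : c 0 = c' 0) :
    Monotone fun t : ℝ≥0 => 2 * Real.arcsin (dist (c t) (c' t) / (2 * (t : ℝ))) := by
  intro s t hst
  rcases eq_zero_or_pos s with rfl | hs
  · have : 0 ≤ Real.arcsin (dist (c t) (c' t) / (2 * (t : ℝ))) :=
      Real.arcsin_nonneg.2 (by positivity)
    simpa using this
  · simp only
    rw [two_mul_arcsin_eq_comparisonAngle (t := s) hs dist_nonneg (dist_ray_le h0 s),
      two_mul_arcsin_eq_comparisonAngle (t := t) (hs.trans_le hst) dist_nonneg (dist_ray_le h0 t)]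
    exact Real.arccos_le_arccos (hX.cos_comparison_ray_le h0 hs hs hst hst)

theorem bddAbove_arcsin (f : ℝ≥0 → ℝ) : BddAbove (Set.range fun t => 2 * Real.arcsin (f t)) := by
  refine ⟨Real.pi, ?_⟩
  rintro _ ⟨t, rfl⟩
  linarith [Real.arcsin_le_pi_div_two (f t)]

theorem IsCATZero.titsAngle_eq_iSup (hX : IsCATZero X) {c c' : GeodesicRay X} (h0 : c 0 = c' 0) :
    titsAngle c.endpoint c'.endpoint =
      ⨆ t : ℝ≥0, 2 * Real.arcsin (dist (c t) (c' t) / (2 * (t : ℝ))) :=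
  (tendsto_atTop_ciSup (hX.monotone_arcsin h0) (bddAbove_arcsin _)).limUnder_eq

theorem IsCATZero.comparisonAngle_le_titsAngle (hX : IsCATZero X) {c c' : GeodesicRay X}
    (h0 : c 0 = c' 0) {s t : ℝ≥0} (hs : 0 < s) (ht : 0 < t) :
    comparisonAngle s t (dist (c s) (c' t)) ≤ titsAngle c.endpoint c'.endpoint := by
  refine (Real.arccos_le_arccos (hX.cos_comparison_ray_le h0 hs ht (le_max_left s t)
    (le_max_right s t))).trans ?_
  rw [hX.titsAngle_eq_iSup h0]
  refine le_trans (ge_of_eq ?_) (le_ciSup (bddAbove_arcsin _) (max s t))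
  exact two_mul_arcsin_eq_comparisonAngle (hs.trans_le (le_max_left s t)) dist_nonneg
    (dist_ray_le h0 _)

theorem IsCATZero.titsAngle_mem_Icc (hX : IsCATZero X) {c c' : GeodesicRay X} (h0 : c 0 = c' 0) :
    titsAngle c.endpoint c'.endpoint ∈ Set.Icc 0 Real.pi := by
  rw [hX.titsAngle_eq_iSup h0]
  refine ⟨Real.iSup_nonneg fun t => ?_, ciSup_le fun t => ?_⟩
  · have : 0 ≤ Real.arcsin (dist (c t) (c' t) / (2 * (t : ℝ))) :=
      Real.arcsin_nonneg.2 (by positivity)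
    positivity
  · linarith [Real.arcsin_le_pi_div_two (dist (c t) (c' t) / (2 * (t : ℝ)))]

theorem IsCATZero.exists_cos_comparison_lt (hX : IsCATZero X) {c c' : GeodesicRay X}
    (h0 : c 0 = c' 0) {κ : ℝ} (hκ : Real.cos (titsAngle c.endpoint c'.endpoint) < κ) :
    ∃ s : ℝ≥0, 0 < s ∧ ((s : ℝ) ^ 2 + s ^ 2 - dist (c s) (c' s) ^ 2) / (2 * s * s) ≤ κ := by
  have hlim := tendsto_atTop_ciSup (hX.monotone_arcsin h0) (bddAbove_arcsin _)
  rw [← hX.titsAngle_eq_iSup h0] at hlim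
  have hev := ((Real.continuous_cos.tendsto _).comp hlim).eventually_lt_const hκ
  obtain ⟨s, hs, hs0⟩ := (hev.and (eventually_gt_atTop 0)).exists
  refine ⟨s, hs0, ?_⟩
  have hs1 : (0 : ℝ) < s := hs0
  rw [Function.comp_apply, two_mul_arcsin_eq_comparisonAngle hs1 dist_nonneg (dist_ray_le h0 s),
    comparisonAngle, Real.cos_arccos] at hs
  · exact hs.le
  · rw [le_div_iff₀ (by positivity)]
    nlinarith [pow_le_pow_left₀ dist_nonneg (dist_ray_le h0 s) 2]
  · rw [div_le_one (by positivity)]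
    nlinarith [sq_nonneg (dist (c s) (c' s))]

/-! ### Bounds for Alexandrov angles -/

theorem eventually_nhdsGT_prod {T : ℝ≥0} (hT : 0 < T) :
    ∀ᶠ q : ℝ≥0 × ℝ≥0 in 𝓝[>] 0 ×ˢ 𝓝[>] 0, q.1 ∈ Set.Ioc 0 T ∧ 0 < q.2 :=
  Eventually.prod_mk (pa := (· ∈ Set.Ioc 0 T)) (Ioc_mem_nhdsGT hT) (pb := (0 < ·))
    self_mem_nhdsWithin

theorem IsCATZero.alexandrovAngle_le_titsAngle (hX : IsCATZero X) {c c' : GeodesicRay X}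
    (h0 : c 0 = c' 0) : alexandrovAngle c c' ≤ titsAngle c.endpoint c'.endpoint := by
  refine limsup_le_of_le
    (IsBoundedUnder.isCoboundedUnder_le (isBoundedUnder_of ⟨0, fun q => Real.arccos_nonneg _⟩)) ?_
  filter_upwards [eventually_nhdsGT_prod one_pos] with q hq
  rw [c.dist_zero, h0, c'.dist_zero]
  exact hX.comparisonAngle_le_titsAngle h0 hq.1.1 hq.2

/-- The midpoint inequality for the segment from `L (-u)` to `L u`. -/
theorem IsCATZero.two_mul_sq_dist_le (hX : IsCATZero X) (L : GeodesicLine X) (m : X) {u : ℝ}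
    (hu : 0 < u) :
    2 * dist (L 0) m ^ 2 + 2 * u ^ 2 ≤ dist (L (-u)) m ^ 2 + dist (L u) m ^ 2 := by
  obtain ⟨τ, hτ⟩ := hX.exists_geodesic (L (-u)) m
  have hσ := (L.shift (-u)).isGeodesicSegment (T := 2 * u) (by positivity)
  have e0 : L.shift (-u) 0 = L (-u) := by simp [GeodesicLine.shift]
  have e1 : L.shift (-u) (2 * u) = L u := by simp only [GeodesicLine.shift]; congr 1; ring
  have e2 : L.shift (-u) u = L 0 := by simp [GeodesicLine.shift]
  have hl : dist (L (-u)) (L u) = 2 * u := by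
    rw [L.dist_eq, abs_of_nonpos (by linarith)]; ring
  rw [e0, e1] at hσ
  have h := hX.mul_sq_dist_le (s := u) (t := dist (L (-u)) m) hσ hτ
    ⟨hu.le, by rw [hl]; linarith⟩ ⟨dist_nonneg, le_rfl⟩
  rw [e2, hτ.target, hl] at h
  -- The comparison inequality carries a factor `dist (L (-u)) m`, void when it vanishes.
  rcases (dist_nonneg (x := L (-u)) (y := m)).eq_or_lt with hb | hb
  · rw [← dist_eq_zero.1 hb.symm, L.dist_eq, dist_comm (L u), hl, dist_self]
    simp [sq_abs]
    nlinarith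
  · refine le_of_mul_le_mul_left ?_ (mul_pos hu hb)
    nlinarith

/-- A comparison triangle with base the segment from `L 0` back to `L (-T)` and apex at infinity
bounds the angle at `L 0` on the backward side from above; the midpoint inequality turns this into a
lower bound for the angle with the forward half of `L`. -/
theorem IsCATZero.arccos_le_alexandrovAngle [ProperSpace X] (hX : IsCATZero X) (L : GeodesicLine X)
    {c c' : GeodesicRay X} (h0 : c' 0 = L 0) (h : Asymptotic c' c) {T : ℝ} (hT : 0 < T) :
    Real.arccos ((busemann c (L (-T)) - busemann c (L 0)) / T) ≤ alexandrovAngle L.posRay c' := by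
  have hτ := L.reverse.isGeodesicSegment hT.le
  have e0 : L.reverse 0 = c' 0 := by simp [GeodesicLine.reverse, h0]
  have hl : dist (c' 0) (L.reverse T) = T := by
    rw [← e0, L.reverse.dist_eq]; simp [abs_of_pos hT]
  rw [e0] at hτ
  refine le_limsup_of_frequently_le (Eventually.frequently ?_)
    (isBoundedUnder_of ⟨Real.pi, fun q => Real.arccos_le_pi _⟩)
  filter_upwards [eventually_nhdsGT_prod (Real.toNNReal_pos.2 hT)] with ⟨u, v⟩ ⟨⟨hu, huT⟩, hv⟩
  rw [L.posRay.dist_zero, show L.posRay 0 = c' 0 from h0.symm, c'.dist_zero]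
  refine Real.arccos_le_arccos ?_
  have hu' : (0 : ℝ) < u := hu
  have hv' : (0 : ℝ) < v := hv
  have hb := hX.busemann_sub_div_le h hτ (u := u) (v := v)
    (by rw [hl]; exact ⟨hu, (Real.le_toNNReal_iff_coe_le hT.le).1 huT⟩) hv
  have hm := hX.two_mul_sq_dist_le L (c' v) hu'
  rw [hl, h0] at hb
  rw [← h0, c'.dist_zero] at hm
  rw [← neg_le_neg_iff, ← neg_div, neg_sub]
  refine le_trans hb (le_trans ?_ (neg_div _ _).le)
  simp only [GeodesicLine.reverse, GeodesicLine.posRay]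
  gcongr
  linarith

/-! ### Lines at bounded distance from a line -/

/-- A line in a neighbourhood of another one follows it, in one direction or the other. -/
theorem GeodesicLine.exists_fellow_travel (R L : GeodesicLine X) {D : ℝ}
    (h : ∀ τ, ∃ s, dist (L τ) (R s) ≤ D) (t : ℝ) :
    ∃ (M : GeodesicLine X) (a : ℝ), M 0 = L t ∧ ∀ τ, dist (M τ) (R (a + τ)) ≤ 11 * D := by
  have hφ : ∀ τ, ∃ s, dist (L (t + τ)) (R s) ≤ D := fun τ => h _
  choose φ hφ using hφ
  have hD : 0 ≤ D := dist_nonneg.trans (hφ 0)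
  have hqi : ∀ τ τ', |φ τ - φ τ'| ≤ |τ - τ'| + 2 * D ∧ |τ - τ'| ≤ |φ τ - φ τ'| + 2 * D := by
    intro τ τ'
    have h1 := dist_triangle4 (R (φ τ)) (L (t + τ)) (L (t + τ')) (R (φ τ'))
    have h2 := dist_triangle4 (L (t + τ)) (R (φ τ)) (R (φ τ')) (L (t + τ'))
    have h3 := hφ τ
    have h4 := hφ τ'
    rw [dist_comm (R (φ τ)) (L _), L.dist_eq, R.dist_eq, add_sub_add_left_eq_sub] at h1
    rw [dist_comm (R (φ τ')) (L _), L.dist_eq, R.dist_eq, add_sub_add_left_eq_sub] at h2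
    constructor <;> linarith
  have hT := hqi (4 * D + 1) 0
  -- The parameter `4 * D + 1` is so large that the direction in which `φ` moves from `0` to it
  -- decides the direction of `φ` at every parameter farther than `4 * D` from `0`.
  rcases le_total (φ 0) (φ (4 * D + 1)) with hs | hs
  · refine ⟨L.shift t, φ 0, by simp [GeodesicLine.shift], fun τ => ?_⟩
    have h1 : |φ τ - (φ 0 + τ)| ≤ 10 * D := by
      have h2 := hqi τ 0
      have h3 := hqi τ (4 * D + 1)
      grind
    have h2 := dist_triangle (L (t + τ)) (R (φ τ)) (R (φ 0 + τ))
    rw [R.dist_eq (φ τ)] at h2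
    have h3 := hφ τ
    simp only [GeodesicLine.shift]
    linarith
  · refine ⟨(L.shift t).reverse, φ 0, by simp [GeodesicLine.shift, GeodesicLine.reverse],
      fun τ => ?_⟩
    have h1 : |φ (-τ) - (φ 0 + τ)| ≤ 10 * D := by
      have h2 := hqi (-τ) 0
      have h3 := hqi (-τ) (4 * D + 1)
      grind
    have h2 := dist_triangle (L (t + -τ)) (R (φ (-τ))) (R (φ 0 + τ))
    rw [R.dist_eq (φ (-τ))] at h2
    have h3 := hφ (-τ)
    simp only [GeodesicLine.shift, GeodesicLine.reverse]
    linarith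

/-- If points near `R (a k)` converge to the positive endpoint of `R`, the parameters `a k` tend to
`+∞`. They are unbounded because the points leave every ball, and they are not negative because
the segments from `R 0` to the points start along the positive half of `R`. -/
theorem IsCATZero.tendsto_param_atTop (hX : IsCATZero X) (R : GeodesicLine X) {ι : Type*}
    {l : Filter ι} {p : ι → X} {a : ι → ℝ} {D : ℝ} (hpa : ∀ k, dist (p k) (R (a k)) ≤ D)
    (hp : Tendsto p l (coneNhds R.posEnd)) : Tendsto a l atTop := by
  refine tendsto_atTop.2 fun A => ?_
  set r : ℝ≥0 := (|A| + |D| + 1).toNNReal with hr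
  have hr' : (r : ℝ) = |A| + |D| + 1 := Real.coe_toNNReal _ (by positivity)
  have hmem : {x : X | (r : ℝ) < dist (R.posRay 0) x ∧ ∀ γ : ℝ → X,
      IsGeodesicSegment γ (R.posRay 0) x → dist (γ r) (R.posRay r) < 1} ∈ coneNhds R.posEnd :=
    mem_iInf_of_mem R.posRay <| mem_iInf_of_mem rfl <| mem_iInf_of_mem r <| mem_iInf_of_mem 1 <|
      mem_iInf_of_mem one_pos <| mem_principal_self _
  filter_upwards [hp hmem] with k hk
  obtain ⟨hk1, hk2⟩ := hk
  obtain ⟨γ, hγ⟩ := hX.exists_geodesic (R.posRay 0) (p k)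
  have h1 := hk2 γ hγ
  have e0 : R.posRay 0 = R 0 := rfl
  have er : R.posRay r = R r := rfl
  have h2 := hγ.dist_eq r ⟨r.2, hk1.le⟩ _ ⟨dist_nonneg, le_rfl⟩
  rw [hγ.target, abs_of_nonpos (by linarith)] at h2
  rw [e0] at hk1 h2
  rw [er] at h1
  have h3 := dist_triangle4 (R r) (γ r) (p k) (R (a k))
  rw [R.dist_eq, dist_comm (R r)] at h3
  have h4 := dist_triangle (R 0) (R (a k)) (p k)
  rw [R.dist_eq, dist_comm (R (a k))] at h4
  have h5 := hpa k
  have h6 := le_abs_self A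
  have h7 := le_abs_self D
  have h9 := abs_nonneg A
  rw [zero_sub, abs_neg] at h4
  rcases abs_cases (a k) with h8 | h8
  · linarith
  · rw [abs_of_nonneg (by linarith [r.2])] at h3
    linarith

end CatZero

open CatZero in
theorem mainTheorem12 {X : Type*} [MetricSpace X] [ProperSpace X] (hX : CatZero.IsCATZero X)
    (R : CatZero.GeodesicLine X) (y : CatZero.Boundary X) (d : ℝ) (hd : 0 < d)
    (Rk : ℕ → CatZero.GeodesicLine X)
    (hRk : ∀ k, Metric.hausdorffEDist (Set.range (Rk k)) (Set.range R) ≤ ENNReal.ofReal d)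
    (t : ℕ → ℝ)
    (ht : Tendsto (fun k => Rk k (t k)) atTop (CatZero.coneNhds R.posEnd)) :
    Tendsto (fun k => CatZero.angleAt (Rk k (t k)) R.posEnd y) atTop
      (𝓝 (CatZero.titsAngle R.posEnd y)) := by
  have hnear : ∀ k τ, ∃ s, dist (Rk k τ) (R s) ≤ d + 1 := by
    intro k τ
    obtain ⟨_, ⟨s, rfl⟩, hs⟩ := Metric.exists_edist_lt_of_hausdorffEDist_lt
      (Set.mem_range_self τ) ((hRk k).trans_lt
        ((ENNReal.ofReal_lt_ofReal_iff (by linarith)).2 (lt_add_one d)))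
    rw [edist_lt_ofReal] at hs
    exact ⟨s, hs.le⟩
  -- After translation and, possibly, reversal, the line `Rk k` becomes a line `M k` which starts at
  -- `Rk k (t k)` and fellow travels `R`, so that its positive endpoint is that of `R`.
  choose M a hM0 hMa using fun k => R.exists_fellow_travel (Rk k) (hnear k) (t k)
  set D := 11 * (d + 1)
  have hMR : ∀ k, (M k).posRay.endpoint = R.posEnd := by
    intro k
    refine endpoint_eq_iff.2 ⟨D + |a k|, fun s => ?_⟩
    have h1 := dist_triangle (M k s) (R (a k + s)) (R s)
    rw [R.dist_eq, add_sub_cancel_right] at h1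
    exact h1.trans (add_le_add_left (hMa k s) _)
  have ha : Tendsto a atTop atTop := hX.tendsto_param_atTop R (D := D) (fun k => by
    simpa [hM0] using hMa k 0) ht
  obtain ⟨c, hc0, rfl⟩ : ∃ c : GeodesicRay X, c 0 = R.posRay 0 ∧ c.endpoint = y :=
    ⟨_, hX.rayFrom_spec (R.posRay 0) y⟩
  have hang : ∀ k, angleAt (Rk k (t k)) R.posEnd c.endpoint =
      alexandrovAngle (M k).posRay (rayFrom (Rk k (t k)) c.endpoint) := fun k => by
    rw [angleAt, hX.rayFrom_eq (c := (M k).posRay) (hM0 k) (hMR k)]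
  have hfrom := fun k => hX.rayFrom_spec (Rk k (t k)) c.endpoint
  have hα := hX.titsAngle_mem_Icc hc0.symm
  change titsAngle R.posEnd c.endpoint ∈ _ at hα
  set α := titsAngle R.posEnd c.endpoint
  refine tendsto_order.2 ⟨fun β hβ => ?_, fun β hβ => .of_forall fun k => ?_⟩
  · rw [← Real.arccos_cos hα.1 hα.2] at hβ
    have hev := (Real.continuous_arccos.tendsto (Real.cos α)).eventually_const_lt hβ
    obtain ⟨δ, hδ, hδβ⟩ := Metric.eventually_nhds_iff.1 hev
    -- Half of the margin `δ` in the cosine is spent as `δ / 4` on a comparison angle of the rays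
    -- from `R 0`, and as `2 * D / a k ≤ δ / 4` on passing from `R` to `M k`.
    obtain ⟨s, hs, hsκ⟩ := hX.exists_cos_comparison_lt hc0.symm (κ := Real.cos α + δ / 4)
      (by change Real.cos α < _; linarith)
    filter_upwards [ha.eventually_ge_atTop (s : ℝ), ha.eventually_gt_atTop 0,
      ha.eventually_ge_atTop (8 * D / δ)] with k hk hk0 hkD
    rw [hang]
    refine lt_of_lt_of_le (hδβ (y := Real.cos α + δ / 2) ?_) ((Real.arccos_le_arccos ?_).trans
      (hX.arccos_le_alexandrovAngle (M k) ((hfrom k).1.trans (hM0 k).symm)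
        (endpoint_eq_iff.1 (hfrom k).2) hk0))
    · rw [Real.dist_eq, add_sub_cancel_left, abs_of_pos] <;> linarith
    -- The base of the ideal triangle runs from `M k 0`, which is near `R (a k)`, to `M k (-a k)`,
    -- which is near `R 0`.
    · have h1 := hX.neg_mul_le_busemann hc0.symm (S := (a k).toNNReal) hs hs
        (Real.le_toNNReal_iff_coe_le hk0.le |>.2 hk) hsκ
      have h2 := busemann_sub_le c (R (a k)) (M k 0)
      have h3 := busemann_sub_le c (M k (-a k)) (R 0)
      have h4 := hMa k 0
      have h5 := hMa k (-a k)
      have h6 : busemann c (R 0) = 0 := (show c 0 = R 0 from hc0) ▸ busemann_self c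
      rw [show R.posRay (a k).toNNReal = R (a k) by
        simp [GeodesicLine.posRay, hk0.le], Real.coe_toNNReal _ hk0.le] at h1
      rw [add_zero, dist_comm] at h4
      rw [add_neg_cancel] at h5
      rw [div_le_iff₀ hδ] at hkD
      rw [div_le_iff₀ hk0]
      linarith
  · rw [hang]
    refine lt_of_le_of_lt ?_ hβ
    have h := hX.alexandrovAngle_le_titsAngle (c := (M k).posRay)
      (c' := rayFrom (Rk k (t k)) c.endpoint) ((hM0 k).trans (hfrom k).1.symm)
    rwa [hMR, (hfrom k).2] at h
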